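/- Let $d\ge 1$, let $\|\cdot\|$ be any norm on $\mathbb{R}^d$ (used for all normalizations), and let $A\in\mathbb{R}^{d\times d}$ be a Metzler matrix, i.e. $a_{ij}\ge 0$ for $i\neq j$. Let $E$ be the matrix and $\boldsymbol e$ the vector with all entries equal to one, and let $I$ be the identity matrix. A leading eigenvector is a non-negative eigenvector belonging to the leading eigenvalue, which is the (real) eigenvalue with the largest real part among all complex eigenvalues. (1) For every $\varepsilon>0$ the matrix $A+\varepsilon E$ has a unique normalized leading eigenvector $\boldsymbol v_\varepsilon$; the limit $\boldsymbol v=\lim_{\varepsilon\to 0+}\boldsymbol v_\varepsilon$ (the selected leading eigenvector of $A$) exists, and it is a normalized leading eigenvector of $A$. Let $h\ge 0$ be the minimal non-negative number for which $A+hI$ is entrywise non-negative (it exists). For a matrix $B$, say that the power method $\boldsymbol x_{k+1}=B\boldsymbol x_k$, $\boldsymbol x_0=\boldsymbol e$, converges to $\boldsymbol w$ if $\boldsymbol x_k\ne 0$ for all $k$ and $\boldsymbol x_k/\|\boldsymbol x_k\|\to\boldsymbol w$. (2) If $A+hI$ has a non-zero eigenvalue (possibly multiple) that is strictly larger in modulus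 than all its other complex eigenvalues, then the power method for $B=A+hI$ (the translative power method for $A$) converges to $\boldsymbol v$. (3) Without this assumption, whenever the power method for $B=A+hI$ converges, its limit is $\boldsymbol v$. (4) For every $h'>h$, without any further assumption, the power method for $B=A+h'I$ converges to $\boldsymbol v$. -/

import Mathlib

open Filter Topology

/-- A real square matrix is Metzler if its off-diagonal entries are non-negative. -/
def IsMetzler {ι : Type*} (A : Matrix ι ι ℝ) : Prop :=
  ∀ i j, i ≠ j → 0 ≤ A i j

/-- The matrix `E` all of whose entries are one. -/
def onesMatrix (ι : Type*) : Matrix ι ι ℝ := Matrix.of fun _ _ => 1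

/-- The set of complex eigenvalues of a real square matrix. -/
def complexEigenvalues {ι : Type*} [Fintype ι] [DecidableEq ι] (A : Matrix ι ι ℝ) : Set ℂ :=
  spectrum ℂ (A.map (algebraMap ℝ ℂ))

/-- `r` is the leading eigenvalue of `A`: an eigenvalue with the largest real part among all
complex eigenvalues. -/
def IsLeadingEigenvalue {ι : Type*} [Fintype ι] [DecidableEq ι] (A : Matrix ι ι ℝ) (r : ℝ) : Prop :=
  (r : ℂ) ∈ complexEigenvalues A ∧ ∀ z ∈ complexEigenvalues A, z.re ≤ r

/-- `v` is a leading (Perron) eigenvector of `A`, normalized with respect to `ν`: it is a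
non-negative eigenvector, of unit length, belonging to the leading eigenvalue. -/
def IsNormalizedLeadingEigenvector {ι : Type*} [Fintype ι] [DecidableEq ι]
    (ν : Seminorm ℝ (ι → ℝ)) (A : Matrix ι ι ℝ) (v : ι → ℝ) : Prop :=
  v ≠ 0 ∧ 0 ≤ v ∧ ν v = 1 ∧ ∃ r : ℝ, IsLeadingEigenvalue A r ∧ A.mulVec v = r • v

/-- `v` is the selected leading eigenvector of `A`: the limit, as `ε → 0+`, of the normalized
leading eigenvectors of `A + ε E`. -/
def IsSelectedLeadingEigenvector {ι : Type*} [Fintype ι] [DecidableEq ι]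
    (ν : Seminorm ℝ (ι → ℝ)) (A : Matrix ι ι ℝ) (v : ι → ℝ) : Prop :=
  ∃ w : ℝ → ι → ℝ,
    (∀ ε : ℝ, 0 < ε → IsNormalizedLeadingEigenvector ν (A + ε • onesMatrix ι) (w ε)) ∧
    Tendsto w (𝓝[>] 0) (𝓝 v)

/-- The iterates `x (k + 1) = B x k` of the power method, started at `x 0 = x₀`. -/
def powerIterate {ι : Type*} [Fintype ι] (B : Matrix ι ι ℝ) (x₀ : ι → ℝ) : ℕ → ι → ℝ
  | 0 => x₀
  | k + 1 => B.mulVec (powerIterate B x₀ k)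

/-- The power method for `B`, started at `x₀`, converges to `v`: no iterate vanishes, and the
normalized iterates tend to `v`. -/
def PowerMethodConverges {ι : Type*} [Fintype ι] (ν : Seminorm ℝ (ι → ℝ)) (B : Matrix ι ι ℝ)
    (x₀ v : ι → ℝ) : Prop :=
  (∀ k, powerIterate B x₀ k ≠ 0) ∧
    Tendsto (fun k => (ν (powerIterate B x₀ k))⁻¹ • powerIterate B x₀ k) atTop (𝓝 v)

/-- `h` is the minimal non-negative number for which `A + h I` is a non-negative matrix. -/
def IsMinimalShift {ι : Type*} [DecidableEq ι] (A : Matrix ι ι ℝ) (h : ℝ) : Prop :=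
  IsLeast {t : ℝ | 0 ≤ t ∧ ∀ i j, 0 ≤ (A + t • (1 : Matrix ι ι ℝ)) i j} h

/-- `B` has a non-zero eigenvalue, possibly multiple, that is strictly larger in modulus than
every other complex eigenvalue. -/
def HasDominantEigenvalue {ι : Type*} [Fintype ι] [DecidableEq ι] (B : Matrix ι ι ℝ) : Prop :=
  ∃ z ∈ complexEigenvalues B, z ≠ 0 ∧ ∀ w ∈ complexEigenvalues B, w ≠ z → ‖w‖ < ‖z‖

/-! Let `B = A + tI` be a non-negative shift and let `x_ε` be the Perron vector of `B + εE` with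
coordinate sum one and eigenvalue `l_ε`. Then `E x_ε = e`, so `(l_ε I - B) x_ε = ε e`, and the
Neumann series gives `x_ε = ε ∑ l_ε⁻ᵏ⁻¹ Bᵏ e`. Thus `x_ε` is an average of the directions of the
power iterates `Bᵏ e`, with non-negative weights of total one. Each single weight tends to zero with
`ε`, because `l_ε` stays above the Perron root `ρ > 0` of `B`. Hence, if the directions converge,
`x_ε` converges to the same limit (`tendsto_perron_family_of_tendsto_powerIterate`).

The vectors `x_ε` do not depend on the shift `t`, so all convergent power methods for non-negative
shifts of `A` share one limit. It remains to have convergence for some shift. A strictly dominant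
eigenvalue suffices, by generalized eigenspaces (`exists_powerMethodConverges`), and every shift
beyond the minimal one has such an eigenvalue (`hasDominantEigenvalue_add_smul_one`). The existence
of the selected eigenvector is thus deduced from the power method. -/

/-! ### Perron theory of positive matrices -/

theorem exists_pos_le_smul {ι : Type*} [Fintype ι] [Nonempty ι] {a : ι → ℝ} (ha : ∀ i, 0 < a i)
    (b : ι → ℝ) : ∃ M : ℝ, 0 < M ∧ ∀ i, b i ≤ M * a i := by
  refine ⟨∑ i, (|b i| / a i + 1), Finset.sum_pos (fun i _ => ?_) Finset.univ_nonempty, fun i => ?_⟩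
  · have := ha i
    positivity
  · have h1 : |b i| / a i + 1 ≤ ∑ i, (|b i| / a i + 1) :=
      Finset.single_le_sum (f := fun i => |b i| / a i + 1)
        (fun j _ => by have := ha j; positivity) (Finset.mem_univ i)
    have h2 : |b i| / a i ≤ ∑ i, (|b i| / a i + 1) := by linarith
    have h3 := (div_le_iff₀ (ha i)).1 h2
    exact (le_abs_self _).trans h3

theorem sum_pos_of_nonneg_of_ne_zero {ι : Type*} [Fintype ι] {x : ι → ℝ} (hx : 0 ≤ x)
    (hx0 : x ≠ 0) : 0 < ∑ i, x i := by
  obtain ⟨i, hi⟩ := Function.ne_iff.1 hx0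
  exact Finset.sum_pos' (fun j _ => hx j) ⟨i, Finset.mem_univ i, lt_of_le_of_ne (hx i) (Ne.symm hi)⟩

theorem inv_sum_smul_mem_stdSimplex {ι : Type*} [Fintype ι] {x : ι → ℝ} (hx : 0 ≤ x)
    (hx0 : x ≠ 0) : (∑ i, x i)⁻¹ • x ∈ stdSimplex ℝ ι := by
  have hs := sum_pos_of_nonneg_of_ne_zero hx hx0
  refine ⟨fun i => ?_, ?_⟩
  · have := hx i
    simp only [Pi.zero_apply] at this
    simp only [Pi.smul_apply, smul_eq_mul]
    positivity
  · simp only [Pi.smul_apply, smul_eq_mul, ← Finset.mul_sum]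
    exact inv_mul_cancel₀ hs.ne'

theorem Matrix.mulVec_pos_of_pos {ι : Type*} [Fintype ι] {B : Matrix ι ι ℝ}
    (hB : ∀ i j, 0 < B i j) {x : ι → ℝ} (hx : 0 ≤ x) (hx0 : x ≠ 0) (i : ι) :
    0 < B.mulVec x i := by
  obtain ⟨j, hj⟩ := Function.ne_iff.1 hx0
  exact Finset.sum_pos' (fun k _ => mul_nonneg (hB i k).le (hx k))
    ⟨j, Finset.mem_univ j, mul_pos (hB i j) (lt_of_le_of_ne (hx j) (Ne.symm hj))⟩

theorem Matrix.mulVec_mono_of_nonneg {ι : Type*} [Fintype ι] {B : Matrix ι ι ℝ}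
    (hB : ∀ i j, 0 ≤ B i j) {x y : ι → ℝ} (hxy : x ≤ y) : B.mulVec x ≤ B.mulVec y :=
  fun i => Finset.sum_le_sum fun j _ => mul_le_mul_of_nonneg_left (hxy j) (hB i j)

/-- The Perron theorem for positive matrices, with the Collatz–Wielandt bound. -/
theorem Matrix.exists_perron_eigenvector {ι : Type*} [Fintype ι] [Nonempty ι] {B : Matrix ι ι ℝ}
    (hB : ∀ i j, 0 < B i j) :
    ∃ (l : ℝ) (x : ι → ℝ), x ∈ stdSimplex ℝ ι ∧ (∀ i, 0 < x i) ∧ B.mulVec x = l • x ∧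
      ∀ (μ : ℝ) (y : ι → ℝ), 0 ≤ y → y ≠ 0 → μ • y ≤ B.mulVec y → μ ≤ l := by
  have key : ∀ (μ : ℝ) (y : ι → ℝ), y ∈ stdSimplex ℝ ι → μ • y ≤ B.mulVec y →
      μ ≤ ∑ i, ∑ j, B i j := by
    intro μ y hy h
    calc μ = ∑ i, (μ • y) i := by
          simp only [Pi.smul_apply, smul_eq_mul, ← Finset.mul_sum, hy.2, mul_one]
      _ ≤ ∑ i, B.mulVec y i := Finset.sum_le_sum fun i _ => h i
      _ ≤ ∑ i, ∑ j, B i j := by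
          refine Finset.sum_le_sum fun i _ => Finset.sum_le_sum fun j _ => ?_
          exact mul_le_of_le_one_right (hB i j).le
            (hy.2 ▸ Finset.single_le_sum (fun k _ => hy.1 k) (Finset.mem_univ j))
  set M : ℝ := ∑ i, ∑ j, B i j with hM
  have hM0 : 0 ≤ M := Finset.sum_nonneg fun i _ => Finset.sum_nonneg fun j _ => (hB i j).le
  -- Collatz–Wielandt: the Perron root is the largest `μ` with `μ y ≤ B y` for some `y` in the
  -- simplex. The bound `M` makes the set of such pairs with `μ ≥ 0` compact.
  let K : Set (ℝ × (ι → ℝ)) :=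
    (Set.Icc 0 M ×ˢ stdSimplex ℝ ι) ∩ {p | p.1 • p.2 ≤ B.mulVec p.2}
  have hK : IsCompact K := by
    refine (isCompact_Icc.prod (isCompact_stdSimplex ℝ ι)).inter_right ?_
    exact isClosed_le (by fun_prop) (continuous_const.matrix_mulVec continuous_snd)
  have hone : (0 : ι → ℝ) ≤ fun _ => 1 := fun _ => zero_le_one
  have hone' : (fun _ : ι => (1 : ℝ)) ≠ 0 := fun h =>
    one_ne_zero (congrFun h (Classical.arbitrary ι))
  have hne : K.Nonempty := by
    refine ⟨(0, _), ⟨⟨le_rfl, hM0⟩, inv_sum_smul_mem_stdSimplex hone hone'⟩, ?_⟩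
    have h0 := (inv_sum_smul_mem_stdSimplex hone hone').1
    intro i
    simp only [zero_smul, Pi.zero_apply]
    exact Finset.sum_nonneg fun j _ => mul_nonneg (hB i j).le (h0 j)
  obtain ⟨⟨l, x⟩, ⟨⟨hl, hx⟩, hle⟩, hmax⟩ := hK.exists_isMaxOn hne continuous_fst.continuousOn
  simp only at hl hx hle
  have hmax' : ∀ (μ : ℝ) (y : ι → ℝ), 0 ≤ y → y ≠ 0 → μ • y ≤ B.mulVec y → μ ≤ l := by
    intro μ y hy hy0 h
    rcases lt_or_ge μ 0 with hμ | hμ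
    · exact hμ.le.trans hl.1
    · have hs := sum_pos_of_nonneg_of_ne_zero hy hy0
      have hy' := inv_sum_smul_mem_stdSimplex hy hy0
      have h' : μ • ((∑ i, y i)⁻¹ • y) ≤ B.mulVec ((∑ i, y i)⁻¹ • y) := by
        rw [Matrix.mulVec_smul, smul_comm]
        exact smul_le_smul_of_nonneg_left h (inv_nonneg.2 hs.le)
      exact hmax (a := (μ, (∑ i, y i)⁻¹ • y)) ⟨⟨⟨hμ, key _ _ hy' h'⟩, hy'⟩, h'⟩
  have hx0 : x ≠ 0 := by
    rintro rfl
    simpa using hx.2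
  have hBx := Matrix.mulVec_pos_of_pos hB hx.1 hx0
  have heq : B.mulVec x = l • x := by
    by_contra hne
    have hd : 0 ≤ B.mulVec x - l • x := sub_nonneg.2 hle
    have hBd := Matrix.mulVec_pos_of_pos hB hd (sub_ne_zero.2 hne)
    obtain ⟨c, hc, hcle⟩ := exists_pos_le_smul hBd (B.mulVec x)
    have := hmax' (l + c⁻¹) (B.mulVec x) (fun i => (hBx i).le)
      (fun h => (hBx (Classical.arbitrary ι)).ne' (congrFun h _)) (fun i => by
        have h1 := hcle i
        rw [Matrix.mulVec_sub, Matrix.mulVec_smul] at h1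
        simp only [Pi.sub_apply, Pi.smul_apply, smul_eq_mul] at h1 ⊢
        have h2 : c⁻¹ * B.mulVec x i ≤
            B.mulVec (B.mulVec x) i - l * B.mulVec x i := by
          rw [inv_mul_le_iff₀ hc]
          exact h1
        linarith)
    have := inv_pos.2 hc
    linarith
  refine ⟨l, x, hx, fun i => ?_, heq, hmax'⟩
  have h1 := hBx i
  rw [heq, Pi.smul_apply, smul_eq_mul] at h1
  exact lt_of_le_of_ne (hx.1 i) fun h => by simp [← h] at h1

/-- Subtract from `y` the largest multiple of `x` that leaves a non-negative vector. The difference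
vanishes at some `i` and is an eigenvector unless it is zero; positivity of `B` would make its image
positive at `i`. -/
theorem Matrix.perron_eigenvector_unique {ι : Type*} [Fintype ι] [Nonempty ι] {B : Matrix ι ι ℝ}
    (hB : ∀ i j, 0 < B i j) {l : ℝ} {x y : ι → ℝ} (hx : ∀ i, 0 < x i) (hBx : B.mulVec x = l • x)
    (hBy : B.mulVec y = l • y) : ∃ c : ℝ, y = c • x := by
  obtain ⟨i, hi⟩ := Finite.exists_min fun i => y i / x i
  refine ⟨y i / x i, ?_⟩
  by_contra hne
  have hz : 0 ≤ y - (y i / x i) • x := fun j => by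
    have := (le_div_iff₀ (hx j)).1 (hi j)
    simpa using this
  have hpos := Matrix.mulVec_pos_of_pos hB hz (sub_ne_zero.2 hne) i
  rw [Matrix.mulVec_sub, Matrix.mulVec_smul, hBx, hBy] at hpos
  have := (hx i).ne'
  simp only [Pi.sub_apply, Pi.smul_apply, smul_eq_mul] at hpos
  have h : l * y i - y i / x i * (l * x i) = 0 := by field_simp; ring
  exact hpos.ne' h

/-! ### Complex eigenvalues and the Perron root of a non-negative matrix -/

theorem mem_complexEigenvalues_iff {ι : Type*} [Fintype ι] [DecidableEq ι] {A : Matrix ι ι ℝ}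
    {z : ℂ} : z ∈ complexEigenvalues A ↔
      ∃ w : ι → ℂ, w ≠ 0 ∧ (A.map (algebraMap ℝ ℂ)).mulVec w = z • w := by
  rw [complexEigenvalues, ← Matrix.spectrum_toLin', ← Module.End.hasEigenvalue_iff_mem_spectrum]
  constructor
  · intro h
    obtain ⟨w, hw⟩ := h.exists_hasEigenvector
    exact ⟨w, hw.2, by simpa using hw.apply_eq_smul⟩
  · rintro ⟨w, hw0, hw⟩
    exact Module.End.hasEigenvalue_of_hasEigenvector
      (Module.End.hasEigenvector_iff.2 ⟨Module.End.mem_eigenspace_iff.2 (by simpa using hw), hw0⟩)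

theorem Matrix.map_mulVec_ofReal {ι : Type*} [Fintype ι] (A : Matrix ι ι ℝ) (x : ι → ℝ) :
    (A.map (algebraMap ℝ ℂ)).mulVec (fun i => (x i : ℂ)) = fun i => (A.mulVec x i : ℂ) := by
  ext i
  simp [Matrix.mulVec, dotProduct]

theorem ofReal_mem_complexEigenvalues {ι : Type*} [Fintype ι] [DecidableEq ι] {A : Matrix ι ι ℝ}
    {r : ℝ} {x : ι → ℝ} (hx0 : x ≠ 0) (hx : A.mulVec x = r • x) :
    (r : ℂ) ∈ complexEigenvalues A := by
  refine mem_complexEigenvalues_iff.2 ⟨fun i => (x i : ℂ), fun h => hx0 ?_, ?_⟩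
  · ext i
    simpa using congrFun h i
  · rw [Matrix.map_mulVec_ofReal, hx]
    ext i
    simp

theorem mem_complexEigenvalues_add_smul_one {ι : Type*} [Fintype ι] [DecidableEq ι]
    {A : Matrix ι ι ℝ} {t : ℝ} {z : ℂ} :
    z ∈ complexEigenvalues (A + t • (1 : Matrix ι ι ℝ)) ↔ z - t ∈ complexEigenvalues A := by
  simp only [mem_complexEigenvalues_iff]
  refine exists_congr fun w => and_congr_right fun _ => ?_
  have : (A + t • (1 : Matrix ι ι ℝ)).map (algebraMap ℝ ℂ) =
      A.map (algebraMap ℝ ℂ) + (t : ℂ) • (1 : Matrix ι ι ℂ) := by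
    ext i j
    by_cases h : i = j <;> simp [h]
  rw [this, Matrix.add_mulVec, Matrix.smul_mulVec, Matrix.one_mulVec, sub_smul, eq_sub_iff_add_eq]

/-- Take entrywise moduli of a complex eigenvector and apply the triangle inequality. Through the
Collatz–Wielandt bound this controls the moduli of all eigenvalues. -/
theorem exists_norm_smul_le_mulVec {ι : Type*} [Fintype ι] [DecidableEq ι] {A : Matrix ι ι ℝ}
    (hA : ∀ i j, 0 ≤ A i j) {z : ℂ} (hz : z ∈ complexEigenvalues A) :
    ∃ y : ι → ℝ, 0 ≤ y ∧ y ≠ 0 ∧ ‖z‖ • y ≤ A.mulVec y := by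
  obtain ⟨w, hw0, hw⟩ := mem_complexEigenvalues_iff.1 hz
  refine ⟨fun i => ‖w i‖, fun i => norm_nonneg _, fun h => hw0 ?_, fun i => ?_⟩
  · ext i
    simpa using congrFun h i
  · have h1 := congrArg norm (congrFun hw i)
    simp only [Pi.smul_apply, smul_eq_mul, norm_mul] at h1 ⊢
    rw [← h1]
    refine (norm_sum_le _ _).trans (Finset.sum_le_sum fun j _ => ?_)
    simp [abs_of_nonneg (hA i j)]

/-- A non-negative matrix `B` has a Perron eigenpair `(ρ, u)`, and the Perron eigenvalues of the
positive matrices `B + ε E` decrease to `ρ` as `ε` decreases to zero. -/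
theorem Matrix.exists_perron_family {ι : Type*} [Fintype ι] [DecidableEq ι] [Nonempty ι]
    {B : Matrix ι ι ℝ} (hB : ∀ i j, 0 ≤ B i j) :
    ∃ (l : ℝ → ℝ) (x : ℝ → ι → ℝ) (ρ : ℝ) (u : ι → ℝ),
      (∀ ε, 0 < ε → x ε ∈ stdSimplex ℝ ι ∧ (∀ i, 0 < x ε i) ∧
        (B + ε • onesMatrix ι).mulVec (x ε) = l ε • x ε ∧ ρ ≤ l ε ∧
        ∀ z ∈ complexEigenvalues (B + ε • onesMatrix ι), ‖z‖ ≤ l ε) ∧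
      Tendsto l (𝓝[>] 0) (𝓝 ρ) ∧ 0 ≤ u ∧ u ≠ 0 ∧ B.mulVec u = ρ • u ∧
      ∀ z ∈ complexEigenvalues B, ‖z‖ ≤ ρ := by
  have hpos : ∀ ε : ℝ, 0 < ε → ∀ i j, 0 < (B + ε • onesMatrix ι) i j := fun ε hε i j => by
    have := hB i j
    simp only [onesMatrix, Matrix.add_apply, Matrix.smul_apply, Matrix.of_apply, smul_eq_mul]
    linarith
  have hmon : ∀ {s t : ℝ}, s ≤ t → ∀ y : ι → ℝ, 0 ≤ y →
      (B + s • onesMatrix ι).mulVec y ≤ (B + t • onesMatrix ι).mulVec y := by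
    intro s t hst y hy i
    refine Finset.sum_le_sum fun j _ => mul_le_mul_of_nonneg_right ?_ (hy j)
    simp [onesMatrix, hst]
  have hB0 : B + (0 : ℝ) • onesMatrix ι = B := by simp
  have hfam : ∀ ε : ℝ, ∃ (l : ℝ) (x : ι → ℝ), 0 < ε → x ∈ stdSimplex ℝ ι ∧ (∀ i, 0 < x i) ∧
      (B + ε • onesMatrix ι).mulVec x = l • x ∧ ∀ (μ : ℝ) (y : ι → ℝ), 0 ≤ y → y ≠ 0 →
        μ • y ≤ (B + ε • onesMatrix ι).mulVec y → μ ≤ l := by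
    intro ε
    by_cases hε : 0 < ε
    · obtain ⟨l, x, h⟩ := Matrix.exists_perron_eigenvector (hpos ε hε)
      exact ⟨l, x, fun _ => h⟩
    · exact ⟨0, 0, fun h => (hε h).elim⟩
  choose l x h using hfam
  have hx0 : ∀ ε, 0 < ε → x ε ≠ 0 := fun ε hε h0 =>
    ((h ε hε).2.1 (Classical.arbitrary ι)).ne' (congrFun h0 _)
  have hlmon : MonotoneOn l (Set.Ioi 0) := by
    intro s hs t ht hst
    refine (h t ht).2.2.2 _ (x s) (h s hs).1.1 (hx0 s hs) ?_
    rw [← (h s hs).2.2.1]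
    exact hmon hst _ (h s hs).1.1
  have heig : ∀ z ∈ complexEigenvalues B, ∀ ε, 0 < ε → ‖z‖ ≤ l ε := by
    intro z hz ε hε
    obtain ⟨y, hy, hy0, hle⟩ := exists_norm_smul_le_mulVec hB hz
    refine (h ε hε).2.2.2 _ y hy hy0 (hle.trans ?_)
    have := hmon hε.le y hy
    rwa [hB0] at this
  have hl0 : ∀ ε, 0 < ε → 0 ≤ l ε := fun ε hε =>
    (h ε hε).2.2.2 0 (x ε) (h ε hε).1.1 (hx0 ε hε) (by
      rw [zero_smul]
      exact fun i => (Matrix.mulVec_pos_of_pos (hpos ε hε) (h ε hε).1.1 (hx0 ε hε) i).le)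
  have hbdd : BddBelow (l '' Set.Ioi 0) := ⟨0, by rintro _ ⟨ε, hε, rfl⟩; exact hl0 ε hε⟩
  -- Since `l` is monotone and bounded below, its right limit at zero is its infimum, which serves
  -- as `ρ`.
  have hlim := hlmon.tendsto_nhdsGT hbdd
  set ρ := sInf (l '' Set.Ioi 0)
  have hseq : Tendsto (fun n : ℕ => 1 / ((n : ℝ) + 1)) atTop (𝓝[>] 0) :=
    tendsto_nhdsWithin_iff.2 ⟨tendsto_one_div_add_atTop_nhds_zero_nat,
      Eventually.of_forall fun n => by simp only [Set.mem_Ioi]; positivity⟩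
  have hseqpos : ∀ n : ℕ, 0 < 1 / ((n : ℝ) + 1) := fun n => by positivity
  -- Compactness yields only a subsequential limit, which is enough for some Perron vector of `B`.
  -- Convergence of the whole family needs the resolvent argument.
  obtain ⟨u, hu, φ, hφ, hφu⟩ := (isCompact_stdSimplex ℝ ι).tendsto_subseq
    (x := fun n : ℕ => x (1 / ((n : ℝ) + 1))) fun n => (h _ (hseqpos n)).1
  have hseqφ := hseq.comp hφ.tendsto_atTop
  refine ⟨l, x, ρ, u, fun ε hε => ⟨(h ε hε).1, (h ε hε).2.1, (h ε hε).2.2.1,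
    csInf_le hbdd ⟨ε, hε, rfl⟩, fun z hz => ?_⟩, hlim, hu.1, ?_, ?_, fun z hz =>
      ge_of_tendsto hlim (eventually_nhdsWithin_of_forall fun ε hε => heig z hz ε hε)⟩
  · obtain ⟨y, hy, hy0, hle⟩ := exists_norm_smul_le_mulVec (fun i j => (hpos ε hε i j).le) hz
    exact (h ε hε).2.2.2 _ y hy hy0 hle
  · rintro rfl
    simpa using hu.2
  · have hlφ := hlim.comp hseqφ
    have h1 : Tendsto (fun n => (l ∘ (fun n : ℕ => 1 / ((n : ℝ) + 1)) ∘ φ) n •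
        ((fun n : ℕ => x (1 / ((n : ℝ) + 1))) ∘ φ) n) atTop (𝓝 (ρ • u)) := hlφ.smul hφu
    have hc : Continuous fun p : ℝ × (ι → ℝ) => (B + p.1 • onesMatrix ι).mulVec p.2 :=
      Continuous.matrix_mulVec (by fun_prop) continuous_snd
    have h2 := (hc.tendsto (0, u)).comp
      ((tendsto_nhds_of_tendsto_nhdsWithin hseqφ).prodMk_nhds hφu)
    simp only [hB0] at h2
    refine tendsto_nhds_unique (h2.congr fun n => ?_) h1
    exact (h _ (hseqpos _)).2.2.1

/-! ### Growth of orbits of a linear map -/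

/-- Binomial expansion of `(N + μ)ᵏ` on a vector killed by `N ^ d`. The number of terms is
independent of `k`; the truncated exponent `k - j` is harmless because the binomial coefficient
vanishes for `j > k`. -/
theorem Module.End.pow_apply_eq_sum_range {V : Type*} [AddCommGroup V] [Module ℂ V]
    (T : Module.End ℂ V) (μ : ℂ) {y : V} {d : ℕ}
    (h : ((T - μ • (1 : Module.End ℂ V)) ^ d) y = 0) (k : ℕ) :
    (T ^ k) y = ∑ j ∈ Finset.range d,
      ((k.choose j : ℂ) * μ ^ (k - j)) • ((T - μ • (1 : Module.End ℂ V)) ^ j) y := by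
  set N := T - μ • (1 : Module.End ℂ V) with hN
  have hT : T = N + μ • 1 := by simp [hN]
  have hcomm : Commute N (μ • (1 : Module.End ℂ V)) := (Commute.one_right N).smul_right μ
  have hvan : ∀ j, d ≤ j → (N ^ j) y = 0 := fun j hj => by
    rw [← Nat.sub_add_cancel hj, pow_add, Module.End.mul_apply, h, map_zero]
  have h1 : (T ^ k) y = ∑ j ∈ Finset.range (k + 1),
      ((k.choose j : ℂ) * μ ^ (k - j)) • (N ^ j) y := by
    conv_lhs => rw [hT, hcomm.add_pow]
    rw [LinearMap.sum_apply]
    refine Finset.sum_congr rfl fun j _ => ?_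
    rw [smul_pow, one_pow, mul_smul_one, ← nsmul_eq_mul', LinearMap.smul_apply,
      LinearMap.smul_apply, ← Nat.cast_smul_eq_nsmul ℂ, smul_smul]
  have h2 : ∀ m, ∑ j ∈ Finset.range (k + 1), ((k.choose j : ℂ) * μ ^ (k - j)) • (N ^ j) y =
      ∑ j ∈ Finset.range (k + 1 + m), ((k.choose j : ℂ) * μ ^ (k - j)) • (N ^ j) y := fun m =>
    Finset.sum_subset (Finset.range_subset_range.2 (Nat.le_add_right _ _)) fun j _ hj => by
      rw [Nat.choose_eq_zero_of_lt (by simpa using hj)]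
      simp
  have h3 : ∑ j ∈ Finset.range d, ((k.choose j : ℂ) * μ ^ (k - j)) • (N ^ j) y =
      ∑ j ∈ Finset.range (k + 1 + d), ((k.choose j : ℂ) * μ ^ (k - j)) • (N ^ j) y :=
    Finset.sum_subset (Finset.range_subset_range.2 (Nat.le_add_left _ _)) fun j _ hj => by
      rw [hvan j (by simpa using hj), smul_zero]
  rw [h1, h2 d, h3]

theorem tendsto_choose_div_pow (p : ℕ) :
    Tendsto (fun k : ℕ => (k.choose p : ℝ) / (k : ℝ) ^ p) atTop (𝓝 ((p.factorial : ℝ)⁻¹)) := by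
  have h0 : ∀ᶠ k : ℕ in atTop, (k : ℝ) ^ p / (p.factorial : ℝ) ≠ 0 := by
    filter_upwards [eventually_gt_atTop 0] with k hk
    positivity
  have h1 := (Asymptotics.isEquivalent_iff_tendsto_one h0).1 (isEquivalent_choose p)
  have h2 := h1.mul_const ((p.factorial : ℝ)⁻¹)
  rw [one_mul] at h2
  refine h2.congr' ?_
  filter_upwards [eventually_gt_atTop 0] with k hk
  simp only [Pi.div_apply]
  field_simp

theorem tendsto_choose_div_pow_of_lt {j p : ℕ} (hjp : j < p) :
    Tendsto (fun k : ℕ => (k.choose j : ℝ) / (k : ℝ) ^ p) atTop (𝓝 0) := by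
  have h1 : Tendsto (fun k : ℕ => (k : ℝ) ^ (p - j)) atTop atTop :=
    (tendsto_pow_atTop (by omega)).comp tendsto_natCast_atTop_atTop
  have h2 := (tendsto_choose_div_pow j).mul h1.inv_tendsto_atTop
  rw [mul_zero] at h2
  refine h2.congr fun k => ?_
  simp only [Pi.inv_apply]
  rw [div_mul_eq_mul_div, ← div_eq_mul_inv, div_div, ← pow_add]
  congr 2
  omega

theorem tendsto_choose_mul_pow_of_norm_lt {μ : ℂ} {ρ : ℝ} (hμ : ‖μ‖ < ρ) (j : ℕ) :
    Tendsto (fun k : ℕ => ((ρ : ℂ) ^ k)⁻¹ * ((k.choose j : ℂ) * μ ^ (k - j))) atTop (𝓝 0) := by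
  have hρ : 0 < ρ := (norm_nonneg _).trans_lt hμ
  rcases eq_or_ne μ 0 with rfl | hμ0
  · refine tendsto_const_nhds.congr' ?_
    filter_upwards [eventually_gt_atTop j] with k hk
    rw [zero_pow (by omega)]
    simp
  have hr : |‖μ‖ / ρ| < 1 := by
    rw [abs_of_nonneg (by positivity)]
    exact (div_lt_one hρ).2 hμ
  have h1 := (tendsto_pow_const_mul_const_pow_of_abs_lt_one j hr).const_mul ((‖μ‖ ^ j)⁻¹)
  rw [mul_zero] at h1
  refine squeeze_zero_norm' ?_ h1
  filter_upwards [eventually_ge_atTop j] with k hk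
  have h2 : (k.choose j : ℝ) ≤ (k : ℝ) ^ j := by exact_mod_cast Nat.choose_le_pow k j
  have hn : 0 < ‖μ‖ := norm_pos_iff.2 hμ0
  rw [norm_mul, norm_mul, norm_inv, norm_pow, norm_pow, Complex.norm_natCast,
    Complex.norm_of_nonneg hρ.le, pow_sub₀ _ hn.ne' hk, div_pow]
  calc (ρ ^ k)⁻¹ * ((k.choose j : ℝ) * (‖μ‖ ^ k * (‖μ‖ ^ j)⁻¹))
      ≤ (ρ ^ k)⁻¹ * ((k : ℝ) ^ j * (‖μ‖ ^ k * (‖μ‖ ^ j)⁻¹)) := by gcongr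
    _ = _ := by ring

/-- Only the top index `j = p` survives the scaling by `k ^ p * ρ ^ k`, since `k.choose j` grows
like `k ^ j / j!`. -/
theorem tendsto_choose_mul_pow {ρ : ℝ} (hρ : 0 < ρ) {j p : ℕ} (hjp : j ≤ p) :
    Tendsto (fun k : ℕ => ((k : ℂ) ^ p * (ρ : ℂ) ^ k)⁻¹ * ((k.choose j : ℂ) * (ρ : ℂ) ^ (k - j)))
      atTop (𝓝 (if j = p then ((p.factorial : ℂ) * (ρ : ℂ) ^ p)⁻¹ else 0)) := by
  have h : Tendsto (fun k : ℕ => (k.choose j : ℝ) / (k : ℝ) ^ p * (ρ ^ j)⁻¹) atTop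
      (𝓝 (if j = p then ((p.factorial : ℝ) * ρ ^ p)⁻¹ else 0)) := by
    split_ifs with hj
    · subst hj
      rw [mul_inv]
      exact (tendsto_choose_div_pow j).mul_const _
    · simpa using (tendsto_choose_div_pow_of_lt (lt_of_le_of_ne hjp hj)).mul_const ((ρ ^ j)⁻¹)
  have h' := (Complex.continuous_ofReal.tendsto _).comp h
  have hlim : ((if j = p then ((p.factorial : ℝ) * ρ ^ p)⁻¹ else 0 : ℝ) : ℂ) =
      if j = p then ((p.factorial : ℂ) * (ρ : ℂ) ^ p)⁻¹ else 0 := by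
    split_ifs <;> simp
  rw [hlim] at h'
  refine h'.congr' ?_
  filter_upwards [eventually_ge_atTop j] with k hk
  have hρ' : (ρ : ℂ) ≠ 0 := by exact_mod_cast hρ.ne'
  simp only [Function.comp_apply]
  rw [pow_sub₀ _ hρ' hk]
  push_cast
  have : (ρ : ℂ) ^ k ≠ 0 := pow_ne_zero _ hρ'
  rw [mul_inv, div_eq_mul_inv]
  field_simp

/-- If a positive eigenvalue `ρ` is strictly dominant, the orbit of a vector, divided by
`k ^ p * ρ ^ k` for a suitable `p`, has a non-zero limit unless it is `o(ρ ^ k)`. -/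
theorem Module.End.exists_tendsto_pow_apply {V : Type*} [NormedAddCommGroup V] [NormedSpace ℂ V]
    [FiniteDimensional ℂ V] (T : Module.End ℂ V) {ρ : ℝ} (hρ : 0 < ρ)
    (hdom : ∀ μ : ℂ, T.HasEigenvalue μ → μ ≠ ρ → ‖μ‖ < ρ) (e : V)
    (hne : ¬ Tendsto (fun k : ℕ => ((ρ : ℂ) ^ k)⁻¹ • (T ^ k) e) atTop (𝓝 0)) :
    ∃ (p : ℕ) (u : V), u ≠ 0 ∧
      Tendsto (fun k : ℕ => ((k : ℂ) ^ p * (ρ : ℂ) ^ k)⁻¹ • (T ^ k) e) atTop (𝓝 u) := by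
  -- Generalized eigenvectors for the other eigenvalues contribute `o(ρ ^ k)`, so only the component
  -- `g` belonging to `ρ` matters.
  have hdecomp : ∃ g ∈ T.maxGenEigenspace ρ,
      Tendsto (fun k : ℕ => ((ρ : ℂ) ^ k)⁻¹ • (T ^ k) (e - g)) atTop (𝓝 0) := by
    have he : e ∈ ⨆ μ, T.maxGenEigenspace μ := by
      rw [Module.End.iSup_maxGenEigenspace_eq_top]
      trivial
    refine Submodule.iSup_induction _ (motive := fun y => ∃ g ∈ T.maxGenEigenspace ρ,
      Tendsto (fun k : ℕ => ((ρ : ℂ) ^ k)⁻¹ • (T ^ k) (y - g)) atTop (𝓝 0)) he ?_ ?_ ?_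
    · intro μ y hy
      by_cases hμ : μ = ρ
      · subst hμ
        exact ⟨y, hy, by simp⟩
      refine ⟨0, zero_mem _, ?_⟩
      rw [sub_zero]
      rw [Module.End.mem_maxGenEigenspace] at hy
      obtain ⟨d, hd⟩ := hy
      rcases eq_or_ne y 0 with rfl | hy0
      · simp
      have hev : T.HasEigenvalue μ := by
        refine Module.End.hasEigenvalue_of_hasGenEigenvalue (k := d) ?_
        rw [Module.End.hasGenEigenvalue_iff, Submodule.ne_bot_iff]
        exact ⟨y, Module.End.mem_genEigenspace_nat.2 hd, hy0⟩
      have hlt := hdom μ hev hμ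
      simp_rw [T.pow_apply_eq_sum_range μ hd, Finset.smul_sum, smul_smul]
      have := tendsto_finsetSum (Finset.range d) fun j _ =>
        (tendsto_choose_mul_pow_of_norm_lt hlt j).smul_const
          (((T - μ • (1 : Module.End ℂ V)) ^ j) y)
      simpa using this
    · exact ⟨0, zero_mem _, by simp⟩
    · rintro x y ⟨g, hg, hgt⟩ ⟨g', hg', hgt'⟩
      refine ⟨g + g', add_mem hg hg', ?_⟩
      have := hgt.add hgt'
      rw [add_zero] at this
      refine this.congr fun k => ?_
      rw [← smul_add, ← map_add]
      congr 2
      abel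
  obtain ⟨g, hg, hgt⟩ := hdecomp
  have hg0 : g ≠ 0 := by
    rintro rfl
    rw [sub_zero] at hgt
    exact hne hgt
  rw [Module.End.mem_maxGenEigenspace] at hg
  classical
  -- `p + 1` is the nilpotency index of `T - ρ` on `g`; the last non-zero power applied to `g` gives
  -- the limit direction.
  obtain ⟨p, hp, hp'⟩ : ∃ p, ((T - (ρ : ℂ) • (1 : Module.End ℂ V)) ^ (p + 1)) g = 0 ∧
      ((T - (ρ : ℂ) • (1 : Module.End ℂ V)) ^ p) g ≠ 0 := by
    have h0 : Nat.find hg ≠ 0 := fun h => hg0 (by simpa [h] using Nat.find_spec hg)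
    refine ⟨Nat.find hg - 1, ?_, Nat.find_min hg (by omega)⟩
    rw [Nat.sub_add_cancel (Nat.one_le_iff_ne_zero.2 h0)]
    exact Nat.find_spec hg
  have hρ' : (ρ : ℂ) ≠ 0 := by exact_mod_cast hρ.ne'
  refine ⟨p, ((p.factorial : ℂ) * (ρ : ℂ) ^ p)⁻¹ •
    ((T - (ρ : ℂ) • (1 : Module.End ℂ V)) ^ p) g, smul_ne_zero ?_ hp', ?_⟩
  · exact inv_ne_zero (mul_ne_zero (by exact_mod_cast p.factorial_ne_zero) (pow_ne_zero _ hρ'))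
  have h1 : Tendsto (fun k : ℕ => ((k : ℂ) ^ p)⁻¹ • ((ρ : ℂ) ^ k)⁻¹ • (T ^ k) (e - g))
      atTop (𝓝 0) := by
    refine squeeze_zero_norm (fun k => ?_) (tendsto_zero_iff_norm_tendsto_zero.1 hgt)
    rw [norm_smul]
    refine mul_le_of_le_one_left (norm_nonneg _) ?_
    rw [norm_inv, norm_pow, Complex.norm_natCast]
    -- At `k = 0` the factor `(k ^ p)⁻¹` is one for `p = 0` and zero otherwise, since `0⁻¹ = 0`.
    rcases Nat.eq_zero_or_pos k with rfl | hk
    · rcases Nat.eq_zero_or_pos p with rfl | hp0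
      · simp
      · simp [hp0.ne']
    · exact inv_le_one_of_one_le₀ (one_le_pow₀ (by exact_mod_cast hk))
  have h2 := tendsto_finsetSum (Finset.range (p + 1)) fun j hj =>
    (tendsto_choose_mul_pow hρ (Nat.lt_succ_iff.1 (Finset.mem_range.1 hj))).smul_const
      (((T - (ρ : ℂ) • (1 : Module.End ℂ V)) ^ j) g)
  have h3 := h1.add h2
  simp only [ite_smul, zero_smul, Finset.sum_ite_eq', Finset.mem_range, Nat.lt_succ_self,
    if_true, zero_add] at h3
  refine h3.congr fun k => ?_
  have hsum := T.pow_apply_eq_sum_range (ρ : ℂ) hp k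
  simp_rw [← smul_smul _ _ (((T - (ρ : ℂ) • (1 : Module.End ℂ V)) ^ _) g)]
  simp_rw [mul_smul] at hsum ⊢
  rw [← Finset.smul_sum, ← hsum, smul_smul, ← mul_inv, ← smul_add, ← map_add, sub_add_cancel]

/-! ### Normalization and convergence of the power method -/

theorem Seminorm.continuous_pi_real {ι : Type*} [Fintype ι] (ν : Seminorm ℝ (ι → ℝ)) :
    Continuous ν :=
  (ν.convexOn.locallyLipschitz).continuous

theorem Seminorm.pos_of_ne_zero {V : Type*} [AddCommGroup V] [Module ℝ V] {ν : Seminorm ℝ V}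
    (hν : ∀ x, ν x = 0 → x = 0) {x : V} (hx : x ≠ 0) : 0 < ν x :=
  lt_of_le_of_ne (apply_nonneg ν x) fun h => hx (hν x h.symm)

theorem Seminorm.inv_smul_smul_of_pos {V : Type*} [AddCommGroup V] [Module ℝ V]
    (ν : Seminorm ℝ V) {c : ℝ} (hc : 0 < c) (x : V) :
    (ν (c • x))⁻¹ • c • x = (ν x)⁻¹ • x := by
  rw [map_smul_eq_mul, Real.norm_of_nonneg hc.le, smul_smul, mul_inv, mul_right_comm,
    inv_mul_cancel₀ hc.ne', one_mul]

theorem Seminorm.map_inv_smul_self {V : Type*} [AddCommGroup V] [Module ℝ V]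
    {ν : Seminorm ℝ V} {x : V} (hx : 0 < ν x) : ν ((ν x)⁻¹ • x) = 1 := by
  rw [map_smul_eq_mul, norm_inv, Real.norm_of_nonneg hx.le, inv_mul_cancel₀ hx.ne']

theorem Filter.Tendsto.inv_seminorm_smul {ι α : Type*} [Fintype ι] {ν : Seminorm ℝ (ι → ℝ)}
    (hν : ∀ x, ν x = 0 → x = 0) {F : Filter α} {f : α → ι → ℝ} {u : ι → ℝ}
    (hf : Tendsto f F (𝓝 u)) (hu : u ≠ 0) :
    Tendsto (fun a => (ν (f a))⁻¹ • f a) F (𝓝 ((ν u)⁻¹ • u)) :=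
  (((ν.continuous_pi_real.tendsto u).comp hf).inv₀ (Seminorm.pos_of_ne_zero hν hu).ne').smul hf

theorem powerIterate_mono {ι : Type*} [Fintype ι] {B : Matrix ι ι ℝ} (hB : ∀ i j, 0 ≤ B i j)
    {x y : ι → ℝ} (hxy : x ≤ y) (k : ℕ) : powerIterate B x k ≤ powerIterate B y k := by
  induction k with
  | zero => exact hxy
  | succ k ih => exact Matrix.mulVec_mono_of_nonneg hB ih

theorem powerIterate_smul {ι : Type*} [Fintype ι] (B : Matrix ι ι ℝ) (c : ℝ) (x : ι → ℝ) (k : ℕ) :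
    powerIterate B (c • x) k = c • powerIterate B x k := by
  induction k with
  | zero => rfl
  | succ k ih => rw [powerIterate, ih, Matrix.mulVec_smul, powerIterate]

theorem powerIterate_nonneg {ι : Type*} [Fintype ι] {B : Matrix ι ι ℝ} (hB : ∀ i j, 0 ≤ B i j)
    {x : ι → ℝ} (hx : 0 ≤ x) (k : ℕ) : 0 ≤ powerIterate B x k := by
  have h := powerIterate_mono hB hx k
  have h0 := powerIterate_smul B 0 (0 : ι → ℝ) k
  simp only [zero_smul] at h0
  rwa [h0] at h

theorem powerIterate_of_eigenvector {ι : Type*} [Fintype ι] {B : Matrix ι ι ℝ} {r : ℝ}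
    {x : ι → ℝ} (hx : B.mulVec x = r • x) (k : ℕ) : powerIterate B x k = r ^ k • x := by
  induction k with
  | zero => simp [powerIterate]
  | succ k ih => rw [powerIterate, ih, Matrix.mulVec_smul, hx, smul_smul, pow_succ]

theorem toLin'_pow_ofReal_apply {ι : Type*} [Fintype ι] [DecidableEq ι] (B : Matrix ι ι ℝ)
    (x : ι → ℝ) (k : ℕ) :
    (Matrix.toLin' (B.map (algebraMap ℝ ℂ)) ^ k) (fun i => (x i : ℂ)) =
      fun i => (powerIterate B x k i : ℂ) := by
  induction k with
  | zero => simp [powerIterate]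
  | succ k ih =>
    rw [pow_succ', Module.End.mul_apply, ih, Matrix.toLin'_apply, Matrix.map_mulVec_ofReal]
    rfl

theorem hasEigenvalue_toLin'_iff {ι : Type*} [Fintype ι] [DecidableEq ι] {B : Matrix ι ι ℝ}
    {z : ℂ} : Module.End.HasEigenvalue (Matrix.toLin' (B.map (algebraMap ℝ ℂ))) z ↔
      z ∈ complexEigenvalues B := by
  rw [complexEigenvalues, ← Matrix.spectrum_toLin', Module.End.hasEigenvalue_iff_mem_spectrum]

/-- The start `e` dominates a multiple of every eigenvector, and non-negative powers preserve the
order. With a non-negative Perron vector, this prevents the orbit of `e` from being `o(ρ ^ k)`. -/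
theorem powerIterate_ones_ge {ι : Type*} [Fintype ι] [Nonempty ι] {B : Matrix ι ι ℝ}
    (hB : ∀ i j, 0 ≤ B i j) {r : ℝ} {x : ι → ℝ} (hx : B.mulVec x = r • x) :
    ∃ M : ℝ, 0 < M ∧ ∀ k i, r ^ k * x i ≤ M * powerIterate B (fun _ => 1) k i := by
  obtain ⟨M, hM, hle⟩ := exists_pos_le_smul (a := fun _ : ι => (1 : ℝ)) (fun _ => one_pos) x
  refine ⟨M, hM, fun k i => ?_⟩
  have h := powerIterate_mono hB (x := x) (y := M • fun _ => (1 : ℝ)) hle k i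
  rwa [powerIterate_smul, powerIterate_of_eigenvector hx] at h

theorem exists_powerMethodConverges {ι : Type*} [Fintype ι] [DecidableEq ι] [Nonempty ι]
    {ν : Seminorm ℝ (ι → ℝ)} (hν : ∀ x, ν x = 0 → x = 0) {B : Matrix ι ι ℝ}
    (hB : ∀ i j, 0 ≤ B i j) (hdom : HasDominantEigenvalue B) :
    ∃ w, PowerMethodConverges ν B (fun _ => 1) w := by
  obtain ⟨-, -, ρ, x, -, -, hx, hx0, hBx, hρ⟩ := Matrix.exists_perron_family hB
  obtain ⟨z, hz, hz0, hlt⟩ := hdom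
  -- No eigenvalue exceeds the Perron root in modulus, so the strictly dominant one must be `ρ`.
  have hρz : (ρ : ℂ) = z := by
    by_contra hne
    have h1 := hlt _ (ofReal_mem_complexEigenvalues hx0 hBx) hne
    have h2 := hρ z hz
    rw [Complex.norm_real] at h1
    exact absurd h1 (not_lt.2 (h2.trans (le_abs_self _)))
  subst hρz
  have hpos : 0 < ρ :=
    lt_of_le_of_ne ((norm_nonneg _).trans (hρ _ hz)) fun h => hz0 (by simp [← h])
  obtain ⟨i, hi⟩ := Function.ne_iff.1 hx0
  have hxi : 0 < x i := lt_of_le_of_ne (hx i) (Ne.symm hi)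
  obtain ⟨M, hM, hge⟩ := powerIterate_ones_ge hB hBx
  set y := powerIterate B (fun _ => 1) with hy
  set T : Module.End ℂ (ι → ℂ) := Matrix.toLin' (B.map (algebraMap ℝ ℂ))
  have hTy : ∀ k, (T ^ k) (fun _ => (1 : ℂ)) = fun j => (y k j : ℂ) := fun k => by
    have h := toLin'_pow_ofReal_apply B (fun _ => 1) k
    simp only [Complex.ofReal_one] at h
    exact h
  have hnot : ¬ Tendsto (fun k : ℕ => ((ρ : ℂ) ^ k)⁻¹ • (T ^ k) (fun _ => (1 : ℂ)))
      atTop (𝓝 0) := by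
    intro h
    have h1 := (tendsto_pi_nhds.1 h i).norm
    simp only [Pi.zero_apply, norm_zero] at h1
    refine absurd (ge_of_tendsto h1 (Eventually.of_forall fun k => ?_))
      (not_le.2 (show 0 < M⁻¹ * x i by positivity))
    rw [hTy]
    simp only [Pi.smul_apply, smul_eq_mul, norm_mul, norm_inv, norm_pow, Complex.norm_real,
      Real.norm_of_nonneg hpos.le]
    have h3 : M⁻¹ * (ρ ^ k * x i) ≤ y k i := (inv_mul_le_iff₀ hM).2 (hge k i)
    calc M⁻¹ * x i = (ρ ^ k)⁻¹ * (M⁻¹ * (ρ ^ k * x i)) := by field_simp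
      _ ≤ (ρ ^ k)⁻¹ * ‖y k i‖ := by
        gcongr
        exact h3.trans (le_abs_self _)
  obtain ⟨p, u, hu0, hu⟩ := T.exists_tendsto_pow_apply hpos
    (fun μ hμ hne => by
      simpa [abs_of_pos hpos] using hlt μ (hasEigenvalue_toLin'_iff.1 hμ) hne) _ hnot
  have hre : ∀ (k : ℕ) (j : ι), (((k : ℂ) ^ p * (ρ : ℂ) ^ k)⁻¹ • (T ^ k) (fun _ => (1 : ℂ))) j =
      ((((k : ℝ) ^ p * ρ ^ k)⁻¹ * y k j : ℝ) : ℂ) := fun k j => by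
    rw [hTy]
    simp
  have hlim : ∀ j, Tendsto (fun k : ℕ => ((((k : ℝ) ^ p * ρ ^ k)⁻¹ * y k j : ℝ) : ℂ))
      atTop (𝓝 (u j)) := fun j => (tendsto_pi_nhds.1 hu j).congr fun k => hre k j
  have him : ∀ j, (u j).im = 0 := fun j =>
    tendsto_nhds_unique (((Complex.continuous_im.tendsto _).comp (hlim j)).congr
      fun k => Complex.ofReal_im _) tendsto_const_nhds
  have hr : Tendsto (fun k : ℕ => ((k : ℝ) ^ p * ρ ^ k)⁻¹ • y k) atTop
      (𝓝 fun j => (u j).re) :=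
    tendsto_pi_nhds.2 fun j => ((Complex.continuous_re.tendsto _).comp (hlim j)).congr
      fun k => Complex.ofReal_re _
  have hr0 : (fun j => (u j).re) ≠ 0 := fun h => hu0 (by
    ext j
    exact Complex.ext (congrFun h j) (him j))
  refine ⟨_, fun k h => ?_, (hr.inv_seminorm_smul hν hr0).congr' ?_⟩
  · have h1 := hge k i
    rw [← hy] at h
    rw [h, Pi.zero_apply, mul_zero] at h1
    have : 0 < ρ ^ k * x i := by positivity
    linarith
  -- The scaling `k ^ p * ρ ^ k` may vanish at `k = 0`; being positive elsewhere, it cancels in the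
  -- normalization.
  · filter_upwards [eventually_gt_atTop 0] with k hk
    exact ν.inv_smul_smul_of_pos (by positivity) _

/-- With zero as the only eigenvalue, the whole space is its generalized eigenspace. This rules out
`ρ = 0` when no iterate vanishes. -/
theorem exists_powerIterate_eq_zero {ι : Type*} [Fintype ι] [DecidableEq ι] {B : Matrix ι ι ℝ}
    (hB : ∀ z ∈ complexEigenvalues B, z = 0) (x : ι → ℝ) : ∃ k, powerIterate B x k = 0 := by
  set T : Module.End ℂ (ι → ℂ) := Matrix.toLin' (B.map (algebraMap ℝ ℂ))
  have hle : ⨆ μ, T.maxGenEigenspace μ ≤ T.maxGenEigenspace 0 := by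
    refine iSup_le fun μ y hy => ?_
    rcases eq_or_ne μ 0 with rfl | hμ
    · exact hy
    rcases eq_or_ne y 0 with rfl | hy0
    · exact zero_mem _
    obtain ⟨d, hd⟩ := (Module.End.mem_maxGenEigenspace _ _ _).1 hy
    refine absurd (hB μ (hasEigenvalue_toLin'_iff.1
      (Module.End.hasEigenvalue_of_hasGenEigenvalue (k := d) ?_))) hμ
    rw [Module.End.hasGenEigenvalue_iff, Submodule.ne_bot_iff]
    exact ⟨y, Module.End.mem_genEigenspace_nat.2 hd, hy0⟩
  rw [Module.End.iSup_maxGenEigenspace_eq_top] at hle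
  obtain ⟨k, hk⟩ := (Module.End.mem_maxGenEigenspace _ _ _).1
    (hle (Submodule.mem_top (x := fun i => (x i : ℂ))))
  refine ⟨k, ?_⟩
  rw [zero_smul, sub_zero, toLin'_pow_ofReal_apply] at hk
  ext i
  simpa using congrFun hk i

/-! ### The resolvent and the Abelian argument -/

/-- The solution of `l y = e + B y` is the sum of the Neumann series `∑ l⁻ᵏ⁻¹ Bᵏ e`. -/
theorem hasSum_powerIterate_ones {ι : Type*} [Fintype ι] [Nonempty ι] {B : Matrix ι ι ℝ}
    (hB : ∀ i j, 0 ≤ B i j) {l : ℝ} (hl : 0 < l) {y : ι → ℝ} (hy : 0 ≤ y)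
    (hBy : l • y = (fun _ => 1) + B.mulVec y) (i : ι) :
    HasSum (fun k => (l ^ (k + 1))⁻¹ * powerIterate B (fun _ => 1) k i) (y i) := by
  set x := powerIterate B (fun _ => 1) with hx
  have hxnn : ∀ k, 0 ≤ x k := powerIterate_nonneg hB fun _ => zero_le_one
  have hynn : ∀ k, 0 ≤ powerIterate B y k := powerIterate_nonneg hB hy
  -- Applying `Bᵏ` to the equation gives `l Bᵏ y = Bᵏ e + Bᵏ⁺¹ y`, so the partial sums telescope.
  have hstep : ∀ k, l • powerIterate B y k = x k + powerIterate B y (k + 1) := by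
    intro k
    induction k with
    | zero => exact hBy
    | succ k ih =>
      rw [powerIterate, ← Matrix.mulVec_smul, ih, Matrix.mulVec_add]
      rfl
  have hpart : ∀ n, ∑ k ∈ Finset.range n, (l ^ (k + 1))⁻¹ * x k i =
      y i - (l ^ n)⁻¹ * powerIterate B y n i := by
    intro n
    induction n with
    | zero => simp [powerIterate]
    | succ n ih =>
      have h := congrFun (hstep n) i
      simp only [Pi.smul_apply, Pi.add_apply, smul_eq_mul] at h
      rw [Finset.sum_range_succ, ih, eq_sub_of_add_eq h.symm, pow_succ]
      field_simp
      ring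
  have hterm : ∀ k, 0 ≤ (l ^ (k + 1))⁻¹ * x k i := fun k => by
    have := hxnn k i
    simp only [Pi.zero_apply] at this
    positivity
  have hsum : Summable fun k => (l ^ (k + 1))⁻¹ * x k i :=
    summable_of_sum_range_le (c := y i) hterm fun n => by
      rw [hpart]
      have := hynn n i
      simp only [Pi.zero_apply] at this
      have h2 : 0 ≤ (l ^ n)⁻¹ * powerIterate B y n i := by positivity
      linarith
  obtain ⟨M, hM, hyM⟩ := exists_pos_le_smul (a := fun _ : ι => (1 : ℝ)) (fun _ => one_pos) y
  rw [hasSum_iff_tendsto_nat_of_nonneg hterm]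
  simp_rw [hpart]
  -- As `y ≤ M e`, the remainder is at most `M * l` times the `n`-th term of a series already known
  -- to converge; no spectral bound on `l` is needed.
  have hrem : Tendsto (fun n => (l ^ n)⁻¹ * powerIterate B y n i) atTop (𝓝 0) := by
    have h1 := hsum.tendsto_atTop_zero.const_mul (M * l)
    rw [mul_zero] at h1
    refine squeeze_zero (fun n => ?_) (fun n => ?_) h1
    · have := hynn n i
      simp only [Pi.zero_apply] at this
      positivity
    · have h2 := powerIterate_mono hB (x := y) (y := M • fun _ => (1 : ℝ)) hyM n i
      rw [powerIterate_smul] at h2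
      simp only [Pi.smul_apply, smul_eq_mul] at h2
      calc (l ^ n)⁻¹ * powerIterate B y n i ≤ (l ^ n)⁻¹ * (M * x n i) := by gcongr
        _ = M * l * ((l ^ (n + 1))⁻¹ * x n i) := by
          rw [pow_succ]
          field_simp
  simpa using tendsto_const_nhds.sub hrem

/-- If the directions of the iterates `Bᵏ e` converge, then so do the positive eigenvectors of
`B + ε E`, to the same limit: an Abelian theorem for the resolvent of `B`. -/
theorem tendsto_perron_family_of_tendsto_powerIterate {ι : Type*} [Fintype ι] [Nonempty ι]
    {B : Matrix ι ι ℝ} (hB : ∀ i j, 0 ≤ B i j) {l : ℝ → ℝ} {x : ℝ → ι → ℝ} {ρ : ℝ} (hρ : 0 < ρ)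
    (hx : ∀ ε, 0 < ε → x ε ∈ stdSimplex ℝ ι ∧
      (B + ε • onesMatrix ι).mulVec (x ε) = l ε • x ε ∧ ρ ≤ l ε) {u : ι → ℝ}
    (hpos : ∀ k, 0 < ∑ i, powerIterate B (fun _ => 1) k i)
    (hu : Tendsto (fun k => (∑ i, powerIterate B (fun _ => 1) k i)⁻¹ •
      powerIterate B (fun _ => 1) k) atTop (𝓝 u)) :
    Tendsto x (𝓝[>] 0) (𝓝 u) := by
  set z := powerIterate B (fun _ => 1) with hz
  refine tendsto_pi_nhds.2 fun i => ?_
  rw [Metric.tendsto_nhds]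
  intro δ hδ
  obtain ⟨K, hK⟩ := (Metric.tendsto_atTop.1 (tendsto_pi_nhds.1 hu i)) (δ / 2) (half_pos hδ)
  have hK' : ∀ k, K ≤ k → |z k i - u i * ∑ j, z k j| ≤ δ / 2 * ∑ j, z k j := fun k hk => by
    have h := (hK k hk).le
    have hs := hpos k
    rw [Real.dist_eq, Pi.smul_apply, smul_eq_mul] at h
    have heq : z k i - u i * ∑ j, z k j = ((∑ j, z k j)⁻¹ * z k i - u i) * ∑ j, z k j := by
      field_simp
    rw [heq, abs_mul, abs_of_pos hs]
    gcongr
  -- Bound for the first `K` terms, uniform in `ε` because `l ε ≥ ρ`.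
  set C : ℝ := ∑ k ∈ Finset.range K, (ρ ^ (k + 1))⁻¹ * |z k i - u i * ∑ j, z k j| with hC
  have hC0 : 0 ≤ C := Finset.sum_nonneg fun k _ => by positivity
  have hmain : ∀ ε, 0 < ε → |x ε i - u i| ≤ ε * C + δ / 2 := by
    intro ε hε
    obtain ⟨hxs, hxe, hle⟩ := hx ε hε
    have hl : 0 < l ε := hρ.trans_le hle
    have hy : (0 : ι → ℝ) ≤ ε⁻¹ • x ε := smul_nonneg (inv_nonneg.2 hε.le) hxs.1
    have hE : (onesMatrix ι).mulVec (x ε) = fun _ => 1 := by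
      ext j
      simp [onesMatrix, Matrix.mulVec, dotProduct, hxs.2]
    have hBy : l ε • ε⁻¹ • x ε = (fun _ => 1) + B.mulVec (ε⁻¹ • x ε) := by
      rw [smul_comm, ← hxe, Matrix.add_mulVec, Matrix.smul_mulVec, hE, smul_add, smul_smul,
        inv_mul_cancel₀ hε.ne', one_smul, Matrix.mulVec_smul, add_comm]
    have hsum := hasSum_powerIterate_ones hB hl hy hBy
    -- Summing over coordinates identifies the total weight as `ε⁻¹`.
    have hs : HasSum (fun k => (l ε ^ (k + 1))⁻¹ * ∑ j, z k j) ε⁻¹ := by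
      have h := hasSum_sum (s := Finset.univ) fun j _ => hsum j
      simp only [← Finset.mul_sum, Pi.smul_apply, smul_eq_mul, hxs.2, mul_one] at h
      exact h
    have hφ := (hsum i).sub (hs.mul_left (u i))
    have hfin := hasSum_sum_of_ne_finset_zero (L := SummationFilter.unconditional ℕ)
      (s := Finset.range K)
      (f := fun k => if k < K then (ρ ^ (k + 1))⁻¹ * |z k i - u i * ∑ j, z k j| else 0)
      fun k hk => if_neg (by simpa using hk)
    have hCeq : ∑ k ∈ Finset.range K,
        (if k < K then (ρ ^ (k + 1))⁻¹ * |z k i - u i * ∑ j, z k j| else 0) = C :=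
      Finset.sum_congr rfl fun k hk => if_pos (Finset.mem_range.1 hk)
    rw [hCeq] at hfin
    -- Head terms are absorbed by `C` and the others by `δ / 2` times their weight; multiplying the
    -- sum by `ε` gives `ε * C + δ / 2`.
    have hbound := hφ.norm_le_of_bounded (hfin.add (hs.mul_left (δ / 2))) fun k => by
      have hw : 0 < (l ε ^ (k + 1))⁻¹ := by positivity
      have heq : (l ε ^ (k + 1))⁻¹ * z k i - u i * ((l ε ^ (k + 1))⁻¹ * ∑ j, z k j) =
          (l ε ^ (k + 1))⁻¹ * (z k i - u i * ∑ j, z k j) := by ring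
      rw [heq, norm_mul, Real.norm_of_nonneg hw.le, Real.norm_eq_abs]
      have hsk := hpos k
      split_ifs with hk
      · have h1 : (l ε ^ (k + 1))⁻¹ ≤ (ρ ^ (k + 1))⁻¹ := by gcongr
        have h2 := mul_le_mul_of_nonneg_right h1 (abs_nonneg (z k i - u i * ∑ j, z k j))
        have h3 : 0 ≤ δ / 2 * ((l ε ^ (k + 1))⁻¹ * ∑ j, z k j) := by positivity
        linarith
      · have h2 := mul_le_mul_of_nonneg_left (hK' k (not_lt.1 hk)) hw.le
        linarith
    have heq : (ε⁻¹ • x ε) i - u i * ε⁻¹ = ε⁻¹ * (x ε i - u i) := by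
      simp only [Pi.smul_apply, smul_eq_mul]
      ring
    rw [heq, norm_mul, norm_inv, Real.norm_of_nonneg hε.le, Real.norm_eq_abs,
      inv_mul_le_iff₀ hε] at hbound
    refine hbound.trans (le_of_eq ?_)
    field_simp
  have hev : ∀ᶠ ε : ℝ in 𝓝[>] 0, ε * C + δ / 2 < δ := by
    have h : Tendsto (fun ε : ℝ => ε * C + δ / 2) (𝓝[>] 0) (𝓝 (0 * C + δ / 2)) :=
      ((continuous_id.mul continuous_const).add continuous_const).continuousWithinAt.tendsto
    exact h.eventually_lt_const (by linarith)
  filter_upwards [hev, self_mem_nhdsWithin] with ε h1 h2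
  rw [Real.dist_eq]
  exact (hmain ε h2).trans_lt h1

/-! ### Shifts and leading eigenvectors -/

theorem IsLeadingEigenvalue.unique {ι : Type*} [Fintype ι] [DecidableEq ι] {A : Matrix ι ι ℝ}
    {r s : ℝ} (hr : IsLeadingEigenvalue A r) (hs : IsLeadingEigenvalue A s) : r = s :=
  le_antisymm (by simpa using hs.2 _ hr.1) (by simpa using hr.2 _ hs.1)

theorem isLeadingEigenvalue_sub_of_norm_le {ι : Type*} [Fintype ι] [DecidableEq ι]
    {A : Matrix ι ι ℝ} {t l : ℝ} {x : ι → ℝ} (hx0 : x ≠ 0)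
    (hx : (A + t • (1 : Matrix ι ι ℝ)).mulVec x = l • x)
    (hl : ∀ z ∈ complexEigenvalues (A + t • (1 : Matrix ι ι ℝ)), ‖z‖ ≤ l) :
    IsLeadingEigenvalue A (l - t) := by
  refine ⟨?_, fun z hz => ?_⟩
  · have h := mem_complexEigenvalues_add_smul_one.1 (ofReal_mem_complexEigenvalues hx0 hx)
    rwa [← Complex.ofReal_sub] at h
  · have h := hl (z + t) (mem_complexEigenvalues_add_smul_one.2 (by simpa using hz))
    have h2 := (Complex.re_le_norm _).trans h
    simp only [Complex.add_re, Complex.ofReal_re] at h2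
    linarith

theorem mulVec_eq_smul_of_add_smul_one {ι : Type*} [Fintype ι] [DecidableEq ι]
    {A : Matrix ι ι ℝ} {t l : ℝ} {x : ι → ℝ} :
    (A + t • (1 : Matrix ι ι ℝ)).mulVec x = l • x ↔ A.mulVec x = (l - t) • x := by
  rw [Matrix.add_mulVec, Matrix.smul_mulVec, Matrix.one_mulVec, sub_smul, eq_sub_iff_add_eq]

theorem isNormalizedLeadingEigenvector_iff_of_pos {ι : Type*} [Fintype ι] [DecidableEq ι]
    [Nonempty ι] {ν : Seminorm ℝ (ι → ℝ)} (hν : ∀ x, ν x = 0 → x = 0) {A : Matrix ι ι ℝ}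
    {t l : ℝ} (hA : ∀ i j, 0 < (A + t • (1 : Matrix ι ι ℝ)) i j) {x : ι → ℝ}
    (hxpos : ∀ i, 0 < x i) (hx : (A + t • (1 : Matrix ι ι ℝ)).mulVec x = l • x)
    (hl : ∀ z ∈ complexEigenvalues (A + t • (1 : Matrix ι ι ℝ)), ‖z‖ ≤ l) {w : ι → ℝ} :
    IsNormalizedLeadingEigenvector ν A w ↔ w = (ν x)⁻¹ • x := by
  have hx0 : x ≠ 0 := fun h => (hxpos (Classical.arbitrary ι)).ne' (congrFun h _)
  have hνx := Seminorm.pos_of_ne_zero hν hx0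
  have hlead := isLeadingEigenvalue_sub_of_norm_le hx0 hx hl
  constructor
  · rintro ⟨hw0, hw, hw1, r, hr, hAw⟩
    rw [hr.unique hlead] at hAw
    obtain ⟨c, rfl⟩ := Matrix.perron_eigenvector_unique hA hxpos hx
      (mulVec_eq_smul_of_add_smul_one.2 hAw)
    have hc0 : c ≠ 0 := fun h => hw0 (by rw [h, zero_smul])
    have hc : 0 < c := by
      have i := Classical.arbitrary ι
      have h := hw i
      simp only [Pi.zero_apply, Pi.smul_apply, smul_eq_mul] at h
      exact lt_of_le_of_ne (nonneg_of_mul_nonneg_left h (hxpos i)) hc0.symm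
    rw [← ν.inv_smul_smul_of_pos hc, hw1, inv_one, one_smul]
  · rintro rfl
    refine ⟨smul_ne_zero (inv_ne_zero hνx.ne') hx0,
      smul_nonneg (inv_nonneg.2 hνx.le) fun i => (hxpos i).le,
      Seminorm.map_inv_smul_self hνx, l - t, hlead, ?_⟩
    rw [Matrix.mulVec_smul, mulVec_eq_smul_of_add_smul_one.1 hx, smul_comm]

/-- The limit of a convergent power method for a non-negative shift of `A` is the limit of the
leading eigenvectors of `A + ε E`, and it is a leading eigenvector of `A`. -/
theorem PowerMethodConverges.tendsto_leadingEigenvector {ι : Type*} [Fintype ι] [DecidableEq ι]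
    [Nonempty ι] {ν : Seminorm ℝ (ι → ℝ)} (hν : ∀ x, ν x = 0 → x = 0) {A : Matrix ι ι ℝ} {t : ℝ}
    (hA : ∀ i j, 0 ≤ (A + t • (1 : Matrix ι ι ℝ)) i j) {w : ι → ℝ}
    (hw : PowerMethodConverges ν (A + t • (1 : Matrix ι ι ℝ)) (fun _ => 1) w) :
    (∀ W : ℝ → ι → ℝ,
      (∀ ε, 0 < ε → IsNormalizedLeadingEigenvector ν (A + ε • onesMatrix ι) (W ε)) →
        Tendsto W (𝓝[>] 0) (𝓝 w)) ∧
      IsNormalizedLeadingEigenvector ν A w := by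
  obtain ⟨hne, hlim⟩ := hw
  set B := A + t • (1 : Matrix ι ι ℝ) with hBdef
  set z := powerIterate B (fun _ => 1) with hz
  have hznn : ∀ k, 0 ≤ z k := powerIterate_nonneg hA fun _ => zero_le_one
  have hνz : ∀ k, 0 < ν (z k) := fun k => Seminorm.pos_of_ne_zero hν (hne k)
  have hw1 : ν w = 1 := tendsto_nhds_unique ((ν.continuous_pi_real.tendsto w).comp hlim)
    (tendsto_const_nhds.congr fun k => (Seminorm.map_inv_smul_self (hνz k)).symm)
  have hw0 : w ≠ 0 := by
    rintro rfl
    simp at hw1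
  have hwnn : 0 ≤ w := ge_of_tendsto' hlim fun k =>
    smul_nonneg (inv_nonneg.2 (hνz k).le) (hznn k)
  have hsw := sum_pos_of_nonneg_of_ne_zero hwnn hw0
  have hsz : ∀ k, 0 < ∑ i, z k i := fun k => sum_pos_of_nonneg_of_ne_zero (hznn k) (hne k)
  obtain ⟨l, x, ρ, u, hfam, hl, hu, hu0, hBu, hρ⟩ := Matrix.exists_perron_family hA
  have hρ0 : 0 < ρ := by
    have h1 := hρ _ (ofReal_mem_complexEigenvalues hu0 hBu)
    refine lt_of_le_of_ne ((norm_nonneg _).trans h1) fun h => ?_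
    obtain ⟨k, hk⟩ := exists_powerIterate_eq_zero
      (fun y hy => norm_le_zero_iff.1 ((hρ y hy).trans h.ge)) fun _ => (1 : ℝ)
    exact hne k hk
  have hdir : Tendsto (fun k => (∑ i, z k i)⁻¹ • z k) atTop (𝓝 ((∑ i, w i)⁻¹ • w)) := by
    have hs : Continuous fun y : ι → ℝ => ∑ i, y i := by fun_prop
    refine ((((hs.tendsto w).comp hlim).inv₀ hsw.ne').smul hlim).congr fun k => ?_
    simp only [Function.comp_apply, Pi.smul_apply, smul_eq_mul, ← Finset.mul_sum]
    rw [smul_smul, mul_inv, mul_right_comm, inv_mul_cancel₀ (inv_ne_zero (hνz k).ne'), one_mul]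
  have hx := tendsto_perron_family_of_tendsto_powerIterate hA hρ0
    (fun ε hε => ⟨(hfam ε hε).1, (hfam ε hε).2.2.1, (hfam ε hε).2.2.2.1⟩) hsz hdir
  have hnorm : Tendsto (fun ε => (ν (x ε))⁻¹ • x ε) (𝓝[>] 0) (𝓝 w) := by
    have h := hx.inv_seminorm_smul hν (smul_ne_zero (inv_ne_zero hsw.ne') hw0)
    rwa [ν.inv_smul_smul_of_pos (inv_pos.2 hsw), hw1, inv_one, one_smul] at h
  refine ⟨fun W hW => ?_, hw0, hwnn, hw1, ρ - t, isLeadingEigenvalue_sub_of_norm_le hu0 hBu hρ,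
    mulVec_eq_smul_of_add_smul_one.1 ?_⟩
  · refine hnorm.congr' ?_
    filter_upwards [self_mem_nhdsWithin] with ε hε
    obtain ⟨-, hxpos, hxe, -, hxl⟩ := hfam ε hε
    -- Shifting and perturbing commute, so the Perron vector of `B + εE` is also the leading
    -- eigenvector of `A + εE`, independently of `t`.
    have hcomm : B + ε • onesMatrix ι = A + ε • onesMatrix ι + t • (1 : Matrix ι ι ℝ) :=
      add_right_comm _ _ _
    have hpos : ∀ i j, 0 < (B + ε • onesMatrix ι) i j := fun i j => by
      have h : ε • onesMatrix ι i j = ε := by simp [onesMatrix]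
      rw [Matrix.add_apply, Matrix.smul_apply, h]
      exact add_pos_of_nonneg_of_pos (hA i j) hε
    rw [hcomm] at hxe hxl hpos
    exact ((isNormalizedLeadingEigenvector_iff_of_pos hν hpos hxpos hxe hxl).1 (hW ε hε)).symm
  -- Pass to the limit in the eigenvector equation of `B + εE`.
  · have hc : Continuous fun p : ℝ × (ι → ℝ) => (B + p.1 • onesMatrix ι).mulVec p.2 :=
      Continuous.matrix_mulVec (by fun_prop) continuous_snd
    have hid : Tendsto (fun ε : ℝ => ε) (𝓝[>] 0) (𝓝 0) :=
      tendsto_nhds_of_tendsto_nhdsWithin tendsto_id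
    have h1 := (hc.tendsto (0, _)).comp (hid.prodMk_nhds hnorm)
    simp only [zero_smul, add_zero] at h1
    refine tendsto_nhds_unique (h1.congr' ?_) (hl.smul hnorm)
    filter_upwards [self_mem_nhdsWithin] with ε hε
    simp only [Function.comp_apply]
    rw [Matrix.mulVec_smul, (hfam ε hε).2.2.1, smul_comm]

/-- The spectrum of `B` lies in the disc of radius `ρ` about zero. Translated by `t > 0`, this disc
meets the circle of radius `ρ + t` about zero only at the point `ρ + t`. -/
theorem hasDominantEigenvalue_add_smul_one {ι : Type*} [Fintype ι] [DecidableEq ι] [Nonempty ι]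
    {B : Matrix ι ι ℝ} (hB : ∀ i j, 0 ≤ B i j) {t : ℝ} (ht : 0 < t) :
    HasDominantEigenvalue (B + t • (1 : Matrix ι ι ℝ)) := by
  obtain ⟨-, -, ρ, u, -, -, hu, hu0, hBu, hρ⟩ := Matrix.exists_perron_family hB
  have hmem := ofReal_mem_complexEigenvalues hu0 hBu
  have hρ0 : 0 ≤ ρ := (norm_nonneg _).trans (hρ _ hmem)
  have hcast : (ρ : ℂ) + t = ((ρ + t : ℝ) : ℂ) := by push_cast; rfl
  refine ⟨ρ + t, mem_complexEigenvalues_add_smul_one.2 (by simpa using hmem), ?_, fun w hw hne => ?_⟩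
  · rw [hcast, Complex.ofReal_ne_zero]
    positivity
  · have h1 := hρ _ (mem_complexEigenvalues_add_smul_one.1 hw)
    rw [hcast, Complex.norm_of_nonneg (by positivity)]
    by_contra! h2
    have hsq : ‖w - t‖ ^ 2 ≤ ρ ^ 2 := by gcongr
    have hsq' : (ρ + t) ^ 2 ≤ ‖w‖ ^ 2 := by gcongr
    rw [Complex.sq_norm, Complex.normSq_apply] at hsq hsq'
    simp only [Complex.sub_re, Complex.ofReal_re, Complex.sub_im, Complex.ofReal_im,
      sub_zero] at hsq
    -- Subtracting `|w - t|² ≤ ρ²` from `|w|² ≥ (ρ + t)²` leaves `2t Re w ≥ 2t(ρ + t)`.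
    have hre : ρ + t ≤ w.re := by
      by_contra! h3
      nlinarith [mul_lt_mul_of_pos_left h3 ht]
    have hre' : w.re - t ≤ ρ := (le_abs_self _).trans
      (abs_le_of_sq_le_sq (by nlinarith [mul_self_nonneg w.im]) hρ0)
    have hreq : w.re = ρ + t := by linarith
    have him : w.im = 0 := by
      rw [hreq] at hsq
      nlinarith [mul_self_nonneg w.im]
    exact hne (by rw [hcast]; exact Complex.ext hreq him)

theorem IsMetzler.exists_isMinimalShift {ι : Type*} [Fintype ι] [DecidableEq ι]
    {A : Matrix ι ι ℝ} (hA : IsMetzler A) : ∃ h, IsMinimalShift A h := by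
  have hiff : ∀ t : ℝ, (∀ i j, 0 ≤ (A + t • (1 : Matrix ι ι ℝ)) i j) ↔ ∀ i, -A i i ≤ t := by
    intro t
    refine ⟨fun h i => ?_, fun h i j => ?_⟩
    · have := h i i
      simp at this
      linarith
    · rcases eq_or_ne i j with rfl | hij
      · have := h i
        simp
        linarith
      · simpa [hij] using hA i j hij
  -- The minimal shift is the maximum of zero and all `-A i i`.
  let s : Finset ℝ := insert 0 (Finset.univ.image fun i => -A i i)
  have hs : s.Nonempty := Finset.insert_nonempty _ _
  refine ⟨s.max' hs, ⟨s.le_max' _ (Finset.mem_insert_self _ _), (hiff _).2 fun i =>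
    s.le_max' _ (Finset.mem_insert_of_mem (Finset.mem_image_of_mem _ (Finset.mem_univ i)))⟩, ?_⟩
  rintro t ⟨ht0, ht⟩
  refine s.max'_le hs _ fun y hy => ?_
  rcases Finset.mem_insert.1 hy with rfl | hy
  · exact ht0
  · obtain ⟨i, -, rfl⟩ := Finset.mem_image.1 hy
    exact (hiff t).1 ht i

theorem existsUnique_isNormalizedLeadingEigenvector {ι : Type*} [Fintype ι] [DecidableEq ι]
    [Nonempty ι] {ν : Seminorm ℝ (ι → ℝ)} (hν : ∀ x, ν x = 0 → x = 0) {A : Matrix ι ι ℝ} {t : ℝ}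
    (hA : ∀ i j, 0 < (A + t • (1 : Matrix ι ι ℝ)) i j) :
    ∃! w, IsNormalizedLeadingEigenvector ν A w := by
  obtain ⟨l, x, hx, hxpos, hBx, hmax⟩ := Matrix.exists_perron_eigenvector hA
  have h := @isNormalizedLeadingEigenvector_iff_of_pos ι _ _ _ ν hν A t l hA x hxpos hBx
    fun z hz => by
      obtain ⟨y, hy, hy0, hle⟩ := exists_norm_smul_le_mulVec (fun i j => (hA i j).le) hz
      exact hmax _ y hy hy0 hle
  exact ⟨_, h.2 rfl, fun w hw => h.1 hw⟩

/-! ### The main theorem -/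

theorem mainTheorem11 {ι : Type*} [Fintype ι] [DecidableEq ι] [Nonempty ι]
    (ν : Seminorm ℝ (ι → ℝ)) (hν : ∀ x, ν x = 0 → x = 0)
    (A : Matrix ι ι ℝ) (hA : IsMetzler A) :
    (∀ ε : ℝ, 0 < ε → ∃! w, IsNormalizedLeadingEigenvector ν (A + ε • onesMatrix ι) w) ∧
    ∃ v : ι → ℝ,
      IsSelectedLeadingEigenvector ν A v ∧
      (∀ v', IsSelectedLeadingEigenvector ν A v' → v' = v) ∧
      IsNormalizedLeadingEigenvector ν A v ∧
      ∃ h : ℝ, IsMinimalShift A h ∧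
        (HasDominantEigenvalue (A + h • (1 : Matrix ι ι ℝ)) →
          PowerMethodConverges ν (A + h • (1 : Matrix ι ι ℝ)) (fun _ => 1) v) ∧
        (∀ w, PowerMethodConverges ν (A + h • (1 : Matrix ι ι ℝ)) (fun _ => 1) w → w = v) ∧
        (∀ h' : ℝ, h < h' →
          PowerMethodConverges ν (A + h' • (1 : Matrix ι ι ℝ)) (fun _ => 1) v) := by
  obtain ⟨h, hh⟩ := hA.exists_isMinimalShift
  have hnn := hh.1.2
  have hshift : ∀ h', A + h' • (1 : Matrix ι ι ℝ) =
      A + h • (1 : Matrix ι ι ℝ) + (h' - h) • (1 : Matrix ι ι ℝ) := fun h' => by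
    rw [add_assoc, ← add_smul, add_sub_cancel]
  have hnn' : ∀ h', h ≤ h' → ∀ i j, 0 ≤ (A + h' • (1 : Matrix ι ι ℝ)) i j := by
    intro h' hle i j
    rw [hshift, Matrix.add_apply]
    refine add_nonneg (hnn i j) ?_
    by_cases hij : i = j <;> simp [hij, hle]
  have hconv : ∀ h', h < h' → ∃ w,
      PowerMethodConverges ν (A + h' • (1 : Matrix ι ι ℝ)) (fun _ => 1) w := by
    intro h' hlt
    refine exists_powerMethodConverges hν (hnn' h' hlt.le) ?_
    rw [hshift]
    exact hasDominantEigenvalue_add_smul_one hnn (sub_pos.2 hlt)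
  have hex : ∀ ε : ℝ, 0 < ε →
      ∃! w, IsNormalizedLeadingEigenvector ν (A + ε • onesMatrix ι) w := by
    intro ε hε
    refine existsUnique_isNormalizedLeadingEigenvector hν (t := h) fun i j => ?_
    rw [add_right_comm, Matrix.add_apply]
    exact add_pos_of_nonneg_of_pos (hnn i j) (by simpa [onesMatrix] using hε)
  have hW : ∃ W : ℝ → ι → ℝ,
      ∀ ε, 0 < ε → IsNormalizedLeadingEigenvector ν (A + ε • onesMatrix ι) (W ε) := by
    have h0 : ∀ ε : ℝ, ∃ w, 0 < ε → IsNormalizedLeadingEigenvector ν (A + ε • onesMatrix ι) w := by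
      intro ε
      by_cases hε : 0 < ε
      · obtain ⟨w, hw, -⟩ := hex ε hε
        exact ⟨w, fun _ => hw⟩
      · exact ⟨0, fun h => (hε h).elim⟩
    exact ⟨fun ε => (h0 ε).choose, fun ε hε => (h0 ε).choose_spec hε⟩
  obtain ⟨W, hW⟩ := hW
  -- Any shift beyond `h` would do; its power limit is taken as `v`.
  obtain ⟨v, hv⟩ := hconv (h + 1) (lt_add_one h)
  have hvlim := hv.tendsto_leadingEigenvector hν (hnn' _ (le_add_of_nonneg_right zero_le_one))
  -- Every convergent power method is compared with the same family `W`, whose limit is unique.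
  have hunique : ∀ h', h ≤ h' → ∀ w,
      PowerMethodConverges ν (A + h' • (1 : Matrix ι ι ℝ)) (fun _ => 1) w → w = v :=
    fun h' hle w hw => tendsto_nhds_unique
      ((hw.tendsto_leadingEigenvector hν (hnn' h' hle)).1 W hW) (hvlim.1 W hW)
  refine ⟨hex, v, ⟨W, hW, hvlim.1 W hW⟩, ?_, hvlim.2, h, hh, fun hdom => ?_, hunique h le_rfl,
    fun h' hlt => ?_⟩
  · rintro v' ⟨W', hW', hlim⟩
    exact tendsto_nhds_unique hlim (hvlim.1 W' hW')
  · obtain ⟨w, hw⟩ := exists_powerMethodConverges hν hnn hdom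
    exact hunique h le_rfl w hw ▸ hw
  · obtain ⟨w, hw⟩ := hconv h' hlt
    exact hunique h' hlt.le w hw ▸ hw
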